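/- Let $K$ be a field, $n,s\ge 0$ integers, $R=K[X_1,\dots,X_n]$ the polynomial ring with its standard grading ($\deg X_i=1$), and $\mathfrak m=(X_1,\dots,X_n)$ its irrelevant maximal ideal. Assume $\mathfrak m^s\neq 0$, that is, $n\ge 1$ or $s=0$. For a finitely generated $\mathbb Z$-graded $R$-module $M=\bigoplus_{k\in\mathbb Z}M_k$ let $H_M(T)=\sum_{k\in\mathbb Z}(\dim_K M_k)\,T^k$ be its Hilbert series, and let $\operatorname{depth} M$ be the supremum of the lengths of $M$-regular sequences contained in $\mathfrak m$ (with $\operatorname{depth} 0=\infty$). Then the Hilbert depth of the graded module $\mathfrak m^s$, $$ \operatorname{Hdepth}\mathfrak m^s=\max\{\operatorname{depth} N : N \text{ a finitely generated graded } R\text{-module with } H_N(T)=H_{\mathfrak m^s}(T)\}, $$ equals $\left\lceil \dfrac{n}{s+1}\right\rceil$. -/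

import Mathlib

universe u

/-- A finitely generated `ℤ`-graded module `N = ⨁ k, N_k` over the standard graded polynomial ring
`R = K[X_1, …, X_n]` (every variable has degree `1`): the graded pieces are `K`-subspaces, `N` is
their internal direct sum, and a form of degree `i` maps `N_k` into `N_{i + k}`. -/
structure GradedModuleFG (K : Type u) [Field K] (n : ℕ) where
  carrier : Type u
  [addCommGroup : AddCommGroup carrier]
  [moduleBase : Module K carrier]
  [module : Module (MvPolynomial (Fin n) K) carrier]
  [isScalarTower : IsScalarTower K (MvPolynomial (Fin n) K) carrier]
  [finite : Module.Finite (MvPolynomial (Fin n) K) carrier]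
  piece : ℤ → Submodule K carrier
  isInternal : DirectSum.IsInternal piece
  smul_mem : ∀ (i : ℕ) (k : ℤ) (p : MvPolynomial (Fin n) K) (x : carrier),
    p.IsHomogeneous i → x ∈ piece k → p • x ∈ piece (i + k)

namespace GradedModuleFG

attribute [instance] addCommGroup moduleBase module isScalarTower finite

variable {K : Type u} [Field K] {n : ℕ}

/-- The Hilbert function `H(N, k) = dim_K N_k`, i.e. the family of coefficients of the
Hilbert series of `N`. -/
noncomputable def hilbertFunction (N : GradedModuleFG K n) (k : ℤ) : ℕ :=
  Module.finrank K (N.piece k)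

/-- The depth of `N`: the supremum of the lengths of the `N`-regular sequences contained in the
irrelevant maximal ideal `𝔪 = (X_1, …, X_n)`. (A sequence in `𝔪` that is weakly regular on `N ≠ 0`
is regular, because `N ≠ 𝔪 N`; the zero module gets depth `∞`, as usual.) -/
noncomputable def depth (N : GradedModuleFG K n) : ℕ∞ :=
  sSup {l : ℕ∞ | ∃ rs : List (MvPolynomial (Fin n) K),
    (∀ r ∈ rs, r ∈ MvPolynomial.idealOfVars (Fin n) K) ∧
    RingTheory.Sequence.IsWeaklyRegular N.carrier rs ∧ l = rs.length}

/-- `d` is the Hilbert depth of `M`: the maximum of `depth N` over all finitely generated graded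
modules `N` with the same Hilbert series as `M`. The maximum is attained. -/
def IsHilbertDepth (M : GradedModuleFG K n) (d : ℕ∞) : Prop :=
  IsGreatest {e : ℕ∞ | ∃ N : GradedModuleFG K n,
    N.hilbertFunction = M.hilbertFunction ∧ e = N.depth} d

end GradedModuleFG

section IrrelevantPower

variable (K : Type u) [Field K] (n s : ℕ)

/-- The degree `k` part of the ideal `𝔪 ^ s`: its elements all of whose monomials have
degree `k`. -/
def irrelevantPowPiece (k : ℤ) :
    Submodule K ↥((MvPolynomial.idealOfVars (Fin n) K) ^ s) where
  carrier := {x | ∀ d : Fin n →₀ ℕ, MvPolynomial.coeff d x.1 ≠ 0 → (d.degree : ℤ) = k}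
  zero_mem' := fun d h => absurd (MvPolynomial.coeff_zero d) h
  add_mem' := by
    intro x y hx hy d h
    by_contra hd
    apply h
    have h1 : MvPolynomial.coeff d x.1 = 0 := by_contra fun h' => hd (hx d h')
    have h2 : MvPolynomial.coeff d y.1 = 0 := by_contra fun h' => hd (hy d h')
    change MvPolynomial.coeff d (x.1 + y.1) = 0
    rw [MvPolynomial.coeff_add, h1, h2, add_zero]
  smul_mem' := by
    intro c x hx d h
    refine hx d fun h' => h ?_
    change MvPolynomial.coeff d (c • x.1) = 0
    rw [MvPolynomial.coeff_smul, h', smul_zero]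

theorem irrelevantPowPiece_coeff_sum (x : DirectSum ℤ fun k => irrelevantPowPiece K n s k)
    (d : Fin n →₀ ℕ) :
    MvPolynomial.coeff d (DirectSum.coeAddMonoidHom (irrelevantPowPiece K n s) x).1 =
      MvPolynomial.coeff d (x (d.degree : ℤ)).1.1 := by
  classical
  induction x using DirectSum.induction_on with
  | zero => simp
  | of i x =>
    rw [DirectSum.coeAddMonoidHom_of]
    by_cases h : (d.degree : ℤ) = i
    · subst h
      rw [DirectSum.of_eq_same]
    · rw [DirectSum.of_eq_of_ne _ _ _ h]
      by_contra h'
      exact h (x.2 d (by simpa using h'))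
  | add x y hx hy =>
    rw [map_add, DirectSum.add_apply]
    simp only [Submodule.coe_add, MvPolynomial.coeff_add, hx, hy]

theorem irrelevantPowPiece_isInternal : DirectSum.IsInternal (irrelevantPowPiece K n s) := by
  classical
  refine ⟨fun x y hxy => ?_, fun x => ?_⟩
  · refine DFinsupp.ext fun i => Subtype.ext (Subtype.ext (MvPolynomial.ext _ _ fun d => ?_))
    by_cases h : (d.degree : ℤ) = i
    · subst h
      rw [← irrelevantPowPiece_coeff_sum K n s x d, ← irrelevantPowPiece_coeff_sum K n s y d, hxy]
    · have h0 : ∀ z : irrelevantPowPiece K n s i, MvPolynomial.coeff d z.1.1 = 0 :=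
        fun z => by_contra fun h' => h (z.2 d h')
      rw [h0, h0]
  · have hmem : ∀ i : ℕ, MvPolynomial.homogeneousComponent i x.1 ∈
        (MvPolynomial.idealOfVars (Fin n) K) ^ s := by
      intro i
      have hx := x.2
      rw [MvPolynomial.mem_pow_idealOfVars_iff'] at hx ⊢
      intro d hd
      rw [MvPolynomial.coeff_homogeneousComponent]
      split_ifs
      · exact hx d hd
      · rfl
    refine ⟨∑ i ∈ Finset.range (x.1.totalDegree + 1),
      DirectSum.of (fun k => irrelevantPowPiece K n s k) (i : ℤ)
        ⟨⟨MvPolynomial.homogeneousComponent i x.1, hmem i⟩, fun d hd => ?_⟩, ?_⟩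
    · rw [MvPolynomial.coeff_homogeneousComponent] at hd
      by_contra h
      exact hd (if_neg fun h' => h (by exact_mod_cast h'))
    · apply Subtype.ext
      rw [map_sum]
      simp only [DirectSum.coeAddMonoidHom_of, AddSubmonoidClass.coe_finsetSum]
      exact MvPolynomial.sum_homogeneousComponent x.1

/-- The power `𝔪 ^ s` of the irrelevant maximal ideal `𝔪 = (X_1, …, X_n)` of `K[X_1, …, X_n]`,
as a graded module. -/
noncomputable def irrelevantPow : GradedModuleFG K n where
  carrier := ↥((MvPolynomial.idealOfVars (Fin n) K) ^ s)
  piece := irrelevantPowPiece K n s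
  isInternal := irrelevantPowPiece_isInternal K n s
  smul_mem := by
    intro i k p x hp hx d hd
    classical
    have hd' : MvPolynomial.coeff d (p * x.1) ≠ 0 := hd
    rw [MvPolynomial.coeff_mul] at hd'
    obtain ⟨⟨a, b⟩, hab, hne⟩ := Finset.exists_ne_zero_of_sum_ne_zero hd'
    have ha : a.degree = i :=
      by_contra fun h => left_ne_zero_of_mul hne (hp.coeff_eq_zero h)
    have hb := hx b (right_ne_zero_of_mul hne)
    rw [← Finset.HasAntidiagonal.mem_antidiagonal.1 hab, map_add]
    push_cast
    rw [hb, ha]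

end IrrelevantPower

/-! Write h(k) = `n.multichoose k`, the dimension of the degree k part of the polynomial ring. Both
bounds come down to the inequality d(s+1) ≤ n+s, which is d ≤ ⌈n/(s+1)⌉ (`mul_le_iff_le_ceil`).

Upper bound: let N have the Hilbert function of 𝔪^s and a regular sequence of length d. Over an
algebraic closure the sequence may be taken to consist of linear forms ℓ_j. Since N_s is the lowest
piece, it meets 𝔪N trivially, and this makes (u_j) ↦ ∑ ℓ_j u_j an injection N_s^d → N_{s+1}. Hence
d·h(s) ≤ h(s+1) (`length_mul_hilbertFunction_le`), while (s+1)h(s+1) = (n+s)h(s).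

Lower bound: a module free over K[X_1, …, X_d] has depth at least d, and its Hilbert series is that
of its generators divided by (1-T)^d. So (1-T)^d H(T) must have nonnegative coefficients; this is
`truncDiff_nonneg`. From degree s+d on, these coefficients are the Hilbert function of the
polynomial ring in the other n-d variables, so (X_{d+1}, …, X_n)^{s+d} accounts for them. The
finitely many remaining ones are supplied by shifted copies of K[X_1, …, X_d] (`powSumModule`). -/

open RingTheory.Sequence CategoryTheory Abelian
open scoped Pointwise

/-! ### Regular sequences and Ext; independence modulo `I M`. -/

section RegularSequences

variable {R : Type u} [CommRing R]

/-- A weakly regular sequence inside an ideal `I` is regular on modules `M ≠ I M`. -/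
theorem RingTheory.Sequence.IsWeaklyRegular.isRegular_of_smul_top_ne_top
    {M : Type u} [AddCommGroup M] [Module R M] {I : Ideal R}
    (hI : I • (⊤ : Submodule R M) ≠ ⊤) {rs : List R} (hrs : ∀ r ∈ rs, r ∈ I)
    (h : IsWeaklyRegular M rs) : IsRegular M rs := by
  refine ⟨h, fun h' => hI (top_le_iff.1 (h'.le.trans ?_))⟩
  exact Submodule.smul_mono_left (Ideal.span_le.2 hrs)

theorem smul_top_quotSMulTop_ne_top {M : Type u} [AddCommGroup M] [Module R M] {I : Ideal R}
    (hI : I • (⊤ : Submodule R M) ≠ ⊤) {y : R} (hy : y ∈ I) :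
    I • (⊤ : Submodule R (QuotSMulTop y M)) ≠ ⊤ := by
  intro h
  apply hI
  have h1 : (I • (⊤ : Submodule R M)).map (Submodule.mkQ (y • ⊤)) = ⊤ := by
    rw [Submodule.map_smul'', Submodule.map_top, Submodule.range_mkQ, h]
  have h2 : y • (⊤ : Submodule R M) ≤ I • ⊤ := by
    rw [← Submodule.ideal_span_singleton_smul]
    exact Submodule.smul_mono_left ((Ideal.span_singleton_le_iff_mem I).2 hy)
  have h3 := congrArg (Submodule.comap (Submodule.mkQ (y • ⊤))) h1
  rwa [Submodule.comap_map_mkQ, Submodule.comap_top, sup_eq_right.2 h2] at h3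

/-- Passing to the quotient by a regular element of `I` shortens regular sequences in `I` by one,
whatever the regular element is. -/
theorem exists_isWeaklyRegular_quotSMulTop [IsNoetherianRing R] {M : Type u} [AddCommGroup M]
    [Module R M] [Module.Finite R M] {I : Ideal R} (hI : I • (⊤ : Submodule R M) ≠ ⊤)
    {rs : List R} (hrs : ∀ r ∈ rs, r ∈ I) (h : IsWeaklyRegular M rs) {d : ℕ}
    (hd : rs.length = d + 1) {y : R} (hy : y ∈ I) (hyM : IsSMulRegular M y) :
    ∃ rs' : List R, rs'.length = d ∧ (∀ r ∈ rs', r ∈ I) ∧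
      IsWeaklyRegular (QuotSMulTop y M) rs' := by
  let N := ModuleCat.of R (R ⧸ I)
  have hN : Module.support R N = PrimeSpectrum.zeroLocus I := by
    change Module.support R (R ⧸ I) = _
    rw [Module.support_eq_zeroLocus, Ideal.annihilator_quotient]
  have hext := ModuleCat.subsingleton_ext_of_exists_isRegular I N hN.le (ModuleCat.of R M)
    hI.lt_top rs hrs (h.isRegular_of_smul_top_ne_top hI hrs)
  -- In the long exact sequence of 0 → M → M → M/yM → 0, this group sits between Ext^i(R/I, M) and
  -- Ext^{i+1}(R/I, M), and both vanish for i < d.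
  have hext' : ∀ i < d, Subsingleton (Ext N (ModuleCat.of R (QuotSMulTop y M)) i) := by
    intro i hi
    have zero1 := AddCommGrpCat.isZero_of_iff_subsingleton.mpr (hext i (by omega))
    have zero2 := AddCommGrpCat.isZero_of_iff_subsingleton.mpr (hext (i + 1) (by omega))
    have hyM' : IsSMulRegular (ModuleCat.of R M) y := hyM
    exact AddCommGrpCat.subsingleton_of_isZero <| ShortComplex.Exact.isZero_of_both_zeros
      ((Ext.covariant_sequence_exact₃' N hyM'.smulShortComplex_shortExact) i (i + 1) rfl)
      (zero1.eq_zero_of_src _) (zero2.eq_zero_of_tgt _)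
  obtain ⟨rs', h1, h2, h3⟩ := ModuleCat.exists_isRegular_of_exists_subsingleton_ext I d
    (ModuleCat.of R (QuotSMulTop y M)) (smul_top_quotSMulTop_ne_top hI hy).lt_top N hN hext'
  exact ⟨rs', h1, h2, h3.toIsWeaklyRegular⟩

/-- If `A` meets `I M` trivially and `r₁, …, r_d ∈ I` is weakly regular on `M`, then the sum
`r₁ A + ⋯ + r_d A` is direct, and isomorphic to `A ^ d`. -/
theorem RingTheory.Sequence.IsWeaklyRegular.eq_zero_of_sum_smul_eq_zero {A : Type*} [AddGroup A]
    {I : Ideal R} (l : List (R × A)) :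
    ∀ {M : Type u} [AddCommGroup M] [Module R M] (ι : A →+ M)
      (_ : ∀ a, ι a ∈ I • (⊤ : Submodule R M) → a = 0) (_ : ∀ p ∈ l, p.1 ∈ I)
      (_ : IsWeaklyRegular M (l.map Prod.fst)) (_ : (l.map fun p => p.1 • ι p.2).sum = 0),
      ∀ p ∈ l, p.2 = 0 := by
  induction l with
  | nil => simp
  | cons q l ih =>
    intro M _ _ ι hι hl hreg hsum
    rw [List.map_cons, isWeaklyRegular_cons_iff] at hreg
    have hq : q.1 • (⊤ : Submodule R M) ≤ I • ⊤ := by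
      rw [← Submodule.ideal_span_singleton_smul]
      exact Submodule.smul_mono_left
        ((Ideal.span_singleton_le_iff_mem I).2 (hl q List.mem_cons_self))
    rw [List.map_cons, List.sum_cons] at hsum
    -- Modulo `q.1` the first summand disappears, and the condition on `ι` survives because `q.1 • ⊤
    -- ≤ I • ⊤`. Once the tail is zero, regularity of `q.1` settles the head.
    have htail : ∀ p ∈ l, p.2 = 0 := by
      let π : M →ₗ[R] QuotSMulTop q.1 M := Submodule.mkQ _
      refine ih (M := QuotSMulTop q.1 M) (π.toAddMonoidHom.comp ι) (fun a ha => ?_)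
        (fun p hp => hl p (List.mem_cons_of_mem _ hp)) hreg.2 ?_
      · have h1 : (I • (⊤ : Submodule R M)).map π = I • ⊤ := by
          rw [Submodule.map_smul'', Submodule.map_top, Submodule.range_mkQ]
        rw [← h1] at ha
        obtain ⟨v, hv, hva⟩ := ha
        refine hι a ?_
        have h2 : v - ι a ∈ q.1 • (⊤ : Submodule R M) := (Submodule.Quotient.eq _).1 hva
        have := sub_mem hv (hq h2)
        rwa [sub_sub_cancel] at this
      · have h3 := congrArg π hsum
        rw [map_add, map_zero, map_list_sum, List.map_map] at h3
        have h4 : π (q.1 • ι q.2) = 0 :=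
          (Submodule.Quotient.mk_eq_zero _).2 (Submodule.smul_mem_pointwise_smul _ _ _ trivial)
        rw [h4, zero_add] at h3
        rw [← h3]
        congr 1
    intro p hp
    rcases List.mem_cons.1 hp with rfl | hp
    · have h5 : (l.map fun p => p.1 • ι p.2).sum = 0 := by
        refine List.sum_eq_zero fun x hx => ?_
        obtain ⟨p', hp', rfl⟩ := List.mem_map.1 hx
        rw [htail p' hp', map_zero, smul_zero]
      rw [h5, add_zero] at hsum
      refine hι _ ?_
      rw [hreg.1.right_eq_zero_of_smul hsum]
      exact zero_mem _
    · exact htail p hp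

end RegularSequences

/-! ### Regular sequences of linear forms over an infinite field. -/

section LinearForms

open MvPolynomial

variable {L : Type u} [Field L] {n : ℕ}

/-- The linear form with given coefficients. -/
noncomputable def linearForm (L : Type u) [Field L] (n : ℕ) :
    (Fin n → L) →ₗ[L] MvPolynomial (Fin n) L :=
  Fintype.linearCombination L X

theorem linearForm_mem (c : Fin n → L) : linearForm L n c ∈ idealOfVars (Fin n) L := by
  rw [linearForm, Fintype.linearCombination_apply]
  refine sum_mem fun i _ => ?_
  rw [MvPolynomial.smul_eq_C_mul]
  exact Ideal.mul_mem_left _ _ (Ideal.subset_span ⟨i, rfl⟩)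

/-- Linear prime avoidance: the zero divisors on `M` form the union of finitely many associated
primes, each cutting out a subspace of coefficient vectors. A prime containing all linear forms
would contain `x`, so the subspaces are proper, and finitely many of them cannot cover a space over
an infinite field. -/
theorem exists_isSMulRegular_linearForm [Infinite L] {M : Type u} [AddCommGroup M]
    [Module (MvPolynomial (Fin n) L) M] [Module.Finite (MvPolynomial (Fin n) L) M]
    {x : MvPolynomial (Fin n) L} (hx : x ∈ idealOfVars (Fin n) L) (hxM : IsSMulRegular M x) :
    ∃ c, IsSMulRegular M (linearForm L n c) := by
  classical
  have hfin := associatedPrimes.finite (MvPolynomial (Fin n) L) M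
  have hunion := biUnion_associatedPrimes_eq_compl_regular (MvPolynomial (Fin n) L) M
  let f : Ideal (MvPolynomial (Fin n) L) → Submodule L (Fin n → L) := fun p =>
    (p.restrictScalars L).comap (linearForm L n)
  have hs : ⊤ ∉ hfin.toFinset.image f := by
    intro h
    obtain ⟨p, hp, hpf⟩ := Finset.mem_image.1 h
    have hle : idealOfVars (Fin n) L ≤ p := by
      refine Ideal.span_le.2 ?_
      rintro _ ⟨i, rfl⟩
      have hi : Pi.single i 1 ∈ f p := hpf ▸ trivial
      have hi' : linearForm L n (Pi.single i 1) ∈ p := hi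
      rwa [linearForm, Fintype.linearCombination_apply_single, one_smul] at hi'
    have hx' : x ∈ {r | IsSMulRegular M r}ᶜ := by
      rw [← hunion]
      exact Set.mem_biUnion (hfin.mem_toFinset.1 hp) (hle hx)
    exact hx' hxM
  obtain ⟨c, hc⟩ := (Set.ne_univ_iff_exists_notMem _).1 (Subspace.biUnion_ne_univ_of_top_notMem hs)
  refine ⟨c, by_contra fun h => hc ?_⟩
  have h' : linearForm L n c ∈ {r | IsSMulRegular M r}ᶜ := h
  rw [← hunion] at h'
  obtain ⟨p, hp, hcp⟩ := Set.mem_iUnion₂.1 h'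
  exact Set.mem_biUnion (Finset.mem_coe.2 (Finset.mem_image_of_mem f (hfin.mem_toFinset.2 hp))) hcp

/-- Over an infinite field, regular sequences in the irrelevant ideal can be replaced by regular
sequences of linear forms. -/
theorem exists_isWeaklyRegular_linearForm [Infinite L] (rs : List (MvPolynomial (Fin n) L)) :
    ∀ {M : Type u} [AddCommGroup M] [Module (MvPolynomial (Fin n) L) M]
      [Module.Finite (MvPolynomial (Fin n) L) M]
      (_ : idealOfVars (Fin n) L • (⊤ : Submodule (MvPolynomial (Fin n) L) M) ≠ ⊤)
      (_ : ∀ r ∈ rs, r ∈ idealOfVars (Fin n) L) (_ : IsWeaklyRegular M rs),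
      ∃ cs : List (Fin n → L), cs.length = rs.length ∧
        IsWeaklyRegular M (cs.map (linearForm L n)) := by
  generalize hd : rs.length = d
  induction d generalizing rs with
  | zero => exact fun _ _ _ => ⟨[], rfl, .nil _ _⟩
  | succ d ih =>
    intro M _ _ _ hI hrs hreg
    obtain ⟨c, hc⟩ : ∃ c, IsSMulRegular M (linearForm L n c) := by
      cases rs with
      | nil => cases hd
      | cons r rs =>
        exact exists_isSMulRegular_linearForm (hrs r List.mem_cons_self)
          ((isWeaklyRegular_cons_iff _ _ _).1 hreg).1
    obtain ⟨rs', h1, h2, h3⟩ :=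
      exists_isWeaklyRegular_quotSMulTop hI hrs hreg hd (linearForm_mem c) hc
    obtain ⟨cs, hcs, hcs'⟩ := ih rs' h1 (smul_top_quotSMulTop_ne_top hI (linearForm_mem c)) h2 h3
    exact ⟨c :: cs, by simp [hcs], .cons hc hcs'⟩

end LinearForms

open RingTheory.Sequence
open scoped TensorProduct

/-! ### Graded pieces, extension of the ground field, and the growth inequality. -/

namespace GradedModuleFG

open MvPolynomial

variable {K : Type u} [Field K] {n : ℕ} (N : GradedModuleFG K n)

/-- The projection of a graded module onto its degree `k` part. -/
noncomputable def proj (k : ℤ) : N.carrier →ₗ[K] N.piece k :=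
  DirectSum.component K ℤ (fun k => N.piece k) k ∘ₗ
    (LinearEquiv.ofBijective (DirectSum.coeLinearMap N.piece) N.isInternal).symm.toLinearMap

theorem proj_of_mem {k : ℤ} (x : N.piece k) (k' : ℤ) :
    (N.proj k' x : N.carrier) = if k = k' then (x : N.carrier) else 0 := by
  classical
  have h : (LinearEquiv.ofBijective (DirectSum.coeLinearMap N.piece) N.isInternal).symm x =
      DirectSum.lof K ℤ (fun k => N.piece k) k x := by
    rw [LinearEquiv.symm_apply_eq]
    exact (DirectSum.coeLinearMap_lof N.piece k x).symm
  rw [proj, LinearMap.comp_apply, LinearEquiv.coe_coe, h]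
  split_ifs with hk
  · subst hk
    rw [DirectSum.component.lof_self]
  · rw [DirectSum.component.of, dif_neg hk]
    rfl

@[simp]
theorem proj_coe {k : ℤ} (x : N.piece k) : N.proj k x = x :=
  Subtype.ext (by rw [proj_of_mem, if_pos rfl])

theorem iSup_piece : ⨆ k, N.piece k = ⊤ :=
  N.isInternal.submodule_iSup_eq_top

theorem X_smul_mem (i : Fin n) {k : ℤ} {x : N.carrier} (hx : x ∈ N.piece k) :
    (X i : MvPolynomial (Fin n) K) • x ∈ N.piece (k + 1) := by
  have := N.smul_mem 1 k (X i) x (isHomogeneous_X K i) hx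
  rwa [add_comm] at this

/-- A component of `X i • x` in degree s would come from degree s-1, where `N` is zero. This is why
the lowest piece meets 𝔪N trivially. -/
theorem proj_X_smul {s : ℤ} (h : ∀ k < s, N.piece k = ⊥) (i : Fin n) (x : N.carrier) :
    N.proj s ((X i : MvPolynomial (Fin n) K) • x) = 0 := by
  have hx : x ∈ ⨆ k, N.piece k := N.iSup_piece ▸ trivial
  induction hx using Submodule.iSup_induction' with
  | mem k x hx =>
    by_cases hk : k < s
    · rw [h k hk, Submodule.mem_bot] at hx
      rw [hx, smul_zero, map_zero]
    · have := N.proj_of_mem ⟨_, N.X_smul_mem i hx⟩ s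
      rw [if_neg (by omega)] at this
      exact Subtype.ext this
  | zero => rw [smul_zero, map_zero]
  | add x y _ _ hx hy => rw [smul_add, map_add, hx, hy, add_zero]

/-- The graded pieces of a finitely generated graded module are finite dimensional. -/
instance finite_piece (k : ℤ) : Module.Finite K (N.piece k) := by
  classical
  obtain ⟨G, hG⟩ := (Module.finite_def (R := MvPolynomial (Fin n) K) (M := N.carrier)).1 N.finite
  let D := (LinearEquiv.ofBijective (DirectSum.coeLinearMap N.piece) N.isInternal).symm
  let T : Finset ℤ := G.biUnion fun g => DFinsupp.support (D g)
  let f : N.carrier → ℤ → N.carrier := fun g j => N.proj j g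
  let m : (Fin n →₀ ℕ) → MvPolynomial (Fin n) K := fun e => monomial e 1
  -- Monomials times the homogeneous components of the generators span over K. Only finitely many of
  -- these products can have degree k; the sets `E j` bound their exponents.
  have hspan : Submodule.span K {x | ∃ e, ∃ g ∈ G, ∃ j ∈ T, x = m e • f g j} = ⊤ := by
    set W := Submodule.span K {x | ∃ e, ∃ g ∈ G, ∃ j ∈ T, x = m e • f g j} with hW
    have hgW : ∀ e, ∀ g ∈ G, m e • g ∈ W := by
      intro e g hg
      have h1 : g = ∑ j ∈ T, f g j := by
        have h2 : DirectSum.coeLinearMap N.piece (D g) = g :=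
          (LinearEquiv.ofBijective (DirectSum.coeLinearMap N.piece) N.isInternal).apply_symm_apply g
        conv_lhs => rw [← h2, DirectSum.coeLinearMap_eq_dfinsuppSum]
        refine Finset.sum_subset (fun j hj => Finset.mem_biUnion.2 ⟨g, hg, hj⟩) fun j _ hj => ?_
        rw [DFinsupp.notMem_support_iff.1 hj]
        rfl
      rw [h1, Finset.smul_sum]
      exact sum_mem fun j hj => Submodule.subset_span ⟨e, g, hg, j, hj, rfl⟩
    refine top_le_iff.1 fun x _ => ?_
    have hx : x ∈ Submodule.span (MvPolynomial (Fin n) K) (G : Set N.carrier) := hG ▸ trivial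
    obtain ⟨c, -, rfl⟩ := Submodule.mem_span_finset.1 hx
    refine sum_mem fun g hg => ?_
    have h3 : ∀ p : MvPolynomial (Fin n) K, p • g ∈ W := by
      intro p
      induction p using MvPolynomial.induction_on' with
      | monomial e a =>
        have : (monomial e a : MvPolynomial (Fin n) K) = a • m e := by simp [m, smul_monomial]
        rw [this, smul_assoc]
        exact W.smul_mem _ (hgW e g hg)
      | add p q hp hq => rw [add_smul]; exact add_mem hp hq
    exact h3 _
  let E : ℤ → Set (Fin n →₀ ℕ) := fun j => {e | e.degree ≤ (k - j).toNat}
  have hE : ∀ j, (E j).Finite := fun j => Finsupp.finite_of_degree_le _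
  let S : Set (N.piece k) := ⋃ g ∈ G, ⋃ j ∈ T, (fun e => N.proj k (m e • f g j)) '' E j
  have hS : S.Finite := G.finite_toSet.biUnion fun g _ => T.finite_toSet.biUnion fun j _ =>
    (hE j).image _
  refine ⟨Submodule.fg_def.2 ⟨S, hS, top_le_iff.1 ?_⟩⟩
  have hsurj : (⊤ : Submodule K N.carrier).map (N.proj k) = ⊤ := by
    rw [Submodule.map_top, LinearMap.range_eq_top]
    exact fun x => ⟨x, N.proj_coe x⟩
  rw [← hsurj, ← hspan, Submodule.map_span, Submodule.span_le]
  rintro _ ⟨_, ⟨e, g, hg, j, hj, rfl⟩, rfl⟩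
  by_cases he : e ∈ E j
  · exact Submodule.subset_span (Set.mem_biUnion hg (Set.mem_biUnion hj ⟨e, he, rfl⟩))
  · have hmem := N.smul_mem e.degree j (m e) (f g j) (isHomogeneous_monomial 1 rfl)
      (N.proj j g).2
    have h4 := N.proj_of_mem ⟨_, hmem⟩ k
    have he' : ¬ e.degree ≤ (k - j).toNat := he
    rw [if_neg (by omega)] at h4
    have h5 : N.proj k (m e • f g j) = 0 := Subtype.ext h4
    rw [h5]
    exact zero_mem _

section BaseChange

variable (L : Type u) [Field L] [Algebra K L]

attribute [local instance] MvPolynomial.algebraMvPolynomial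

/-- Extension of the ground field. -/
abbrev extendScalars : Type u := MvPolynomial (Fin n) L ⊗[MvPolynomial (Fin n) K] N.carrier

/-- K[X] → L[X] is the base change of K → L. The right side carries the L[X]-action, the left side
the pieces `L ⊗ N_k` with their dimensions unchanged. -/
noncomputable def extendScalarsEquiv : L ⊗[K] N.carrier ≃ₗ[L] N.extendScalars L :=
  (Algebra.IsPushout.cancelBaseChange K L (MvPolynomial (Fin n) K) (MvPolynomial (Fin n) L)
    N.carrier).symm

theorem extendScalarsEquiv_tmul (l : L) (x : N.carrier) :
    N.extendScalarsEquiv L (l ⊗ₜ x) = algebraMap L (MvPolynomial (Fin n) L) l ⊗ₜ x :=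
  Algebra.IsPushout.cancelBaseChange_symm_tmul K L (MvPolynomial (Fin n) K)
    (MvPolynomial (Fin n) L) N.carrier l x

/-- Multiplication by a variable, as a `K`-linear map. -/
noncomputable def mulX (i : Fin n) : N.carrier →ₗ[K] N.carrier :=
  Algebra.lsmul K K N.carrier (X i : MvPolynomial (Fin n) K)

theorem X_smul_extendScalarsEquiv (i : Fin n) (w : L ⊗[K] N.carrier) :
    (X i : MvPolynomial (Fin n) L) • N.extendScalarsEquiv L w =
      N.extendScalarsEquiv L ((N.mulX i).baseChange L w) := by
  induction w with
  | zero => simp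
  | add x y hx hy => rw [map_add, smul_add, hx, hy, map_add, map_add]
  | tmul l x =>
    rw [LinearMap.baseChange_tmul, extendScalarsEquiv_tmul, extendScalarsEquiv_tmul]
    change _ = _ ⊗ₜ ((X i : MvPolynomial (Fin n) K) • x)
    rw [← TensorProduct.smul_tmul, TensorProduct.smul_tmul', smul_eq_mul, Algebra.smul_def]
    congr 2
    exact (MvPolynomial.map_X _ i).symm

/-- The inclusion of the extension of scalars of a graded piece. -/
noncomputable def extendPiece (k : ℤ) : L ⊗[K] N.piece k →ₗ[L] N.extendScalars L :=
  (N.extendScalarsEquiv L).toLinearMap ∘ₗ (N.piece k).subtype.baseChange L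

theorem proj_baseChange_symm {s : ℤ} (h : ∀ k < s, N.piece k = ⊥) {v : N.extendScalars L}
    (hv : v ∈ idealOfVars (Fin n) L • (⊤ : Submodule (MvPolynomial (Fin n) L) _)) :
    (N.proj s).baseChange L ((N.extendScalarsEquiv L).symm v) = 0 := by
  have hX : ∀ (i : Fin n) (v : N.extendScalars L), (N.proj s).baseChange L
      ((N.extendScalarsEquiv L).symm ((X i : MvPolynomial (Fin n) L) • v)) = 0 := by
    intro i v
    obtain ⟨w, rfl⟩ := (N.extendScalarsEquiv L).surjective v
    rw [X_smul_extendScalarsEquiv, LinearEquiv.symm_apply_apply, ← LinearMap.comp_apply,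
      ← LinearMap.baseChange_comp]
    have : N.proj s ∘ₗ N.mulX i = 0 := LinearMap.ext fun x => N.proj_X_smul h i x
    rw [this, LinearMap.baseChange_zero, LinearMap.zero_apply]
  refine Submodule.smul_induction_on hv (fun r hr v _ => ?_) fun x y hx hy => ?_
  · obtain ⟨c, rfl⟩ := Ideal.mem_span_range_iff_exists_fun.1 hr
    rw [Finset.sum_smul, map_sum, map_sum]
    refine Finset.sum_eq_zero fun i _ => ?_
    rw [mul_comm, mul_smul, hX]
  · rw [map_add, map_add, hx, hy, add_zero]

/-- Supplies the condition on `ι` in `IsWeaklyRegular.eq_zero_of_sum_smul_eq_zero`. -/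
theorem eq_zero_of_extendPiece_mem {s : ℤ} (h : ∀ k < s, N.piece k = ⊥) (u : L ⊗[K] N.piece s)
    (hu : N.extendPiece L s u ∈
      idealOfVars (Fin n) L • (⊤ : Submodule (MvPolynomial (Fin n) L) _)) : u = 0 := by
  have h1 := N.proj_baseChange_symm L h hu
  rw [extendPiece, LinearMap.comp_apply, LinearEquiv.coe_coe, LinearEquiv.symm_apply_apply,
    ← LinearMap.comp_apply, ← LinearMap.baseChange_comp] at h1
  have : N.proj s ∘ₗ (N.piece s).subtype = LinearMap.id := LinearMap.ext fun x => N.proj_coe x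
  rwa [this, LinearMap.baseChange_id, LinearMap.id_apply] at h1

/-- Multiplication by a variable on a graded piece. -/
noncomputable def mulXPiece (i : Fin n) (k : ℤ) : N.piece k →ₗ[K] N.piece (k + 1) :=
  (N.mulX i).restrict fun _ hx => N.X_smul_mem i hx

theorem linearForm_smul_extendPiece (c : Fin n → L) (k : ℤ) (u : L ⊗[K] N.piece k) :
    linearForm L n c • N.extendPiece L k u =
      N.extendPiece L (k + 1) (∑ i, c i • (N.mulXPiece i k).baseChange L u) := by
  rw [linearForm, Fintype.linearCombination_apply, Finset.sum_smul, map_sum]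
  refine Finset.sum_congr rfl fun i _ => ?_
  rw [map_smul, smul_assoc]
  congr 1
  rw [extendPiece, extendPiece, LinearMap.comp_apply, LinearMap.comp_apply, LinearEquiv.coe_coe,
    X_smul_extendScalarsEquiv, ← LinearMap.comp_apply, ← LinearMap.comp_apply,
    ← LinearMap.baseChange_comp, ← LinearMap.baseChange_comp]
  rfl

end BaseChange

attribute [local instance] MvPolynomial.algebraMvPolynomial

/-- If `N` starts in degree `s` and has a regular sequence of length `d`, then
`d * dim N_s ≤ dim N_{s + 1}`. -/
theorem length_mul_hilbertFunction_le {s : ℤ} (h : ∀ k < s, N.hilbertFunction k = 0)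
    {rs : List (MvPolynomial (Fin n) K)} (hrs : ∀ r ∈ rs, r ∈ idealOfVars (Fin n) K)
    (hreg : IsWeaklyRegular N.carrier rs) :
    rs.length * N.hilbertFunction s ≤ N.hilbertFunction (s + 1) := by
  have hbot : ∀ k < s, N.piece k = ⊥ := fun k hk => Submodule.finrank_eq_zero.1 (h k hk)
  let L := AlgebraicClosure K
  let A := L ⊗[K] N.piece s
  let B := L ⊗[K] N.piece (s + 1)
  have hA : Module.finrank L A = N.hilbertFunction s := Module.finrank_baseChange
  have hB : Module.finrank L B = N.hilbertFunction (s + 1) := Module.finrank_baseChange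
  by_cases h0 : N.hilbertFunction s = 0
  · rw [h0, mul_zero]; exact Nat.zero_le _
  have hA' : Nontrivial A := Module.nontrivial_of_finrank_pos (R := L) (by omega)
  -- Flatness carries the regular sequence over to L, and nonvanishing of `A` gives `𝔪M ≠ M` there.
  have hflat : Module.Flat (MvPolynomial (Fin n) K) (MvPolynomial (Fin n) L) :=
    Module.Flat.of_linearEquiv
      (Algebra.IsPushout.equiv K (MvPolynomial (Fin n) K) L (MvPolynomial (Fin n) L)).symm.toLinearEquiv
  have hreg' := hreg.of_flat_of_isBaseChange
    (TensorProduct.isBaseChange (MvPolynomial (Fin n) K) N.carrier (MvPolynomial (Fin n) L))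
  have hI : idealOfVars (Fin n) L •
      (⊤ : Submodule (MvPolynomial (Fin n) L) (N.extendScalars L)) ≠ ⊤ := by
    intro h
    obtain ⟨a, ha⟩ := exists_ne (0 : A)
    exact ha (N.eq_zero_of_extendPiece_mem L hbot a (h.symm.le trivial))
  have hmem : ∀ r ∈ rs.map (algebraMap (MvPolynomial (Fin n) K) (MvPolynomial (Fin n) L)),
      r ∈ idealOfVars (Fin n) L := by
    intro r hr
    obtain ⟨q, hq, rfl⟩ := List.mem_map.1 hr
    have : idealOfVars (Fin n) K ≤ (idealOfVars (Fin n) L).comap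
        (algebraMap (MvPolynomial (Fin n) K) (MvPolynomial (Fin n) L)) := by
      refine Ideal.span_le.2 ?_
      rintro _ ⟨i, rfl⟩
      refine Ideal.subset_span ⟨i, (MvPolynomial.map_X _ i).symm⟩
    exact this (hrs q hq)
  obtain ⟨cs, hcs, hlin⟩ := exists_isWeaklyRegular_linearForm _ hI hmem hreg'
  rw [List.length_map] at hcs
  -- `φ` is (u_j) ↦ ∑ ℓ_j u_j, where ℓ_j is the linear form with coefficients `cs.get j`.
  let φ : (Fin cs.length → A) →ₗ[L] B := ∑ j, (∑ i, cs.get j i • (N.mulXPiece i s).baseChange L) ∘ₗ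
    LinearMap.proj j
  have hφ : Function.Injective φ := by
    refine (injective_iff_map_eq_zero φ).2 fun u hu => ?_
    let l : List (MvPolynomial (Fin n) L × A) :=
      List.ofFn fun j => (linearForm L n (cs.get j), u j)
    have hl : l.map Prod.fst = cs.map (linearForm L n) := by
      rw [List.map_ofFn]
      conv_rhs => rw [← List.ofFn_get cs, List.map_ofFn]
      rfl
    have hsum : (l.map fun p => p.1 • (N.extendPiece L s).toAddMonoidHom p.2).sum = 0 := by
      rw [List.map_ofFn, List.sum_ofFn]
      have h1 := congrArg (N.extendPiece L (s + 1)) hu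
      rw [map_zero] at h1
      rw [← h1, LinearMap.sum_apply, map_sum]
      refine Finset.sum_congr rfl fun j _ => ?_
      refine (N.linearForm_smul_extendPiece L (cs.get j) s (u j)).trans ?_
      rw [LinearMap.comp_apply, LinearMap.sum_apply]
      rfl
    have h2 := IsWeaklyRegular.eq_zero_of_sum_smul_eq_zero (I := idealOfVars (Fin n) L) l
      (N.extendPiece L s).toAddMonoidHom (N.eq_zero_of_extendPiece_mem L hbot) ?_ (hl ▸ hlin) hsum
    · exact funext fun j => h2 _ ((List.mem_ofFn' _ _).2 ⟨j, rfl⟩)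
    · intro p hp
      obtain ⟨j, rfl⟩ := (List.mem_ofFn' _ _).1 hp
      exact linearForm_mem _
  have := LinearMap.finrank_le_finrank_of_injective hφ
  rw [Module.finrank_pi_fintype, Finset.sum_const, Finset.card_univ, Fintype.card_fin, hA, hB,
    smul_eq_mul, hcs] at this
  exact this

end GradedModuleFG

/-! ### Coefficients of (1-T)^d times the Hilbert series of 𝔪^s. -/

section Multichoose

open PowerSeries

theorem succ_mul_multichoose_succ (n k : ℕ) :
    (k + 1) * n.multichoose (k + 1) = (n + k) * n.multichoose k := by
  rcases n with _ | n
  · cases k <;> simp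
  · rw [Nat.multichoose_eq, Nat.multichoose_eq]
    have h1 : n + 1 + (k + 1) - 1 = n + k + 1 := by omega
    have h2 : n + 1 + k - 1 = n + k := by omega
    rw [h1, h2, mul_comm, ← Nat.add_one_mul_choose_eq]
    congr 1
    omega

theorem multichoose_pos {n k : ℕ} (h : 0 < n ∨ k = 0) : 0 < n.multichoose k := by
  rcases h with h | rfl
  · rw [Nat.multichoose_eq]
    exact Nat.choose_pos (by omega)
  · simp

/-- The coefficient of `T ^ (s + k)` in `(1 - T) ^ d * ∑ m ≥ s, multichoose n m * T ^ m`. -/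
def truncDiff (n s : ℕ) : ℕ → ℕ → ℤ
  | 0, k => n.multichoose (s + k)
  | d + 1, 0 => truncDiff n s d 0
  | d + 1, k + 1 => truncDiff n s d (k + 1) - truncDiff n s d k

theorem truncDiff_zero_right (n s d : ℕ) : truncDiff n s d 0 = n.multichoose s := by
  induction d with
  | zero => rfl
  | succ d ih => exact ih

/-- By Pascal's rule each difference lowers the number of variables by one, provided it does not
reach across the truncation at degree s. -/
theorem truncDiff_of_le {n s : ℕ} (d : ℕ) : ∀ {k : ℕ}, d ≤ n → d ≤ k →
    truncDiff n s d k = (n - d).multichoose (s + k) := by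
  induction d with
  | zero => exact fun _ _ => rfl
  | succ d ih =>
    intro k hn hk
    obtain ⟨k, rfl⟩ : ∃ j, k = j + 1 := ⟨k - 1, by omega⟩
    rw [truncDiff, ih (by omega) (by omega), ih (by omega) (by omega)]
    obtain ⟨m, hm⟩ : ∃ m, n - d = m + 1 := ⟨n - d - 1, by omega⟩
    have hm' : n - (d + 1) = m := by omega
    rw [hm, hm', ← add_assoc, Nat.multichoose_succ_succ]
    push_cast
    ring

/-- Coefficientwise form of a differential equation. The truncated series F satisfies (1-T)F' = nF +
s·h(s)T^{s-1}, so G = (1-T)^d F satisfies (1-T)G' = (n-d)G + s·h(s)T^{s-1}(1-T)^d. -/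
theorem succ_mul_truncDiff_succ (n s d : ℕ) : ∀ k : ℕ,
    ((s : ℤ) + k + 1) * truncDiff n s d (k + 1) = (s + k + n - d) * truncDiff n s d k +
      (-1) ^ (k + 1) * (s * n.multichoose s * d.choose (k + 1)) := by
  induction d with
  | zero =>
    intro k
    have h : ((s + k : ℕ) + 1 : ℤ) * n.multichoose (s + k + 1) =
        (n + (s + k : ℕ)) * n.multichoose (s + k) := by
      exact_mod_cast succ_mul_multichoose_succ n (s + k)
    simp only [truncDiff, Nat.choose_zero_succ, Nat.cast_zero, mul_zero, add_zero, sub_zero]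
    rw [← add_assoc]
    push_cast at h
    linarith
  | succ d ih =>
    intro k
    cases k with
    | zero =>
      have h := ih 0
      simp only [truncDiff, truncDiff_zero_right, zero_add, Nat.choose_one_right] at h ⊢
      push_cast at h ⊢
      linear_combination h
    | succ k =>
      have h1 := ih k
      have h2 := ih (k + 1)
      rw [truncDiff, truncDiff, Nat.choose_succ_succ' d (k + 1)]
      push_cast at h1 h2 ⊢
      linear_combination h2 - h1

/-- The last term of the recurrence is nonpositive on passing from even to odd k, so nonnegativity
alone does not propagate. The lower bound at even k, produced by the nonnegative term of the
preceding step, is what absorbs it. -/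
theorem truncDiff_nonneg_aux {n s d : ℕ} (h : d * (s + 1) ≤ n + s) (hdn : d ≤ n) (k : ℕ) :
    0 ≤ truncDiff n s d k ∧
      (Even k → (s * n.multichoose s * d.choose k : ℤ) ≤ (s + k) * truncDiff n s d k) := by
  have hdn' : (d : ℤ) ≤ n := by exact_mod_cast hdn
  have h' : (d * (s + 1) : ℤ) ≤ n + s := by exact_mod_cast h
  induction k with
  | zero =>
    rw [truncDiff_zero_right]
    exact ⟨Int.natCast_nonneg _, fun _ => by simp⟩
  | succ k ih =>
    obtain ⟨ih1, ih2⟩ := ih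
    have hrec := succ_mul_truncDiff_succ n s d k
    have hpos : (0 : ℤ) < s + k + 1 := by positivity
    have hcoef : (0 : ℤ) ≤ s + k + n - d := by
      have : (0 : ℤ) ≤ s + k := by positivity
      linarith
    have hmul := mul_nonneg hcoef ih1
    rcases Nat.even_or_odd k with hk | hk
    · rw [hk.add_one.neg_one_pow] at hrec
      refine ⟨?_, fun h => absurd h (Nat.not_even_iff_odd.2 hk.add_one)⟩
      -- For s = 0 the alternating term vanishes; otherwise one may multiply through by s+k > 0.
      rcases Nat.eq_zero_or_pos s with rfl | hs
      · refine nonneg_of_mul_nonneg_right ?_ hpos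
        rw [hrec]
        simpa using hmul
      · have hs' : (1 : ℤ) ≤ s := by exact_mod_cast hs
        have hsk : (0 : ℤ) < s + k := by positivity
        have hk1 : (0 : ℤ) < k + 1 := by positivity
        have hch : (d.choose (k + 1) : ℤ) * (k + 1) = d.choose k * (d - k) := by
          rcases le_or_gt k d with hkd | hkd
          · have := Nat.choose_succ_right_eq d k
            zify [hkd] at this
            exact this
          · rw [Nat.choose_eq_zero_of_lt hkd, Nat.choose_eq_zero_of_lt (by omega)]
            simp
        have hc0 : (0 : ℤ) ≤ s * n.multichoose s * d.choose k := by positivity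
        -- The expression equals the sum of the three quantities in `e1`, `e2`, `e3`; the hypothesis
        -- d(s+1) ≤ n+s enters in `e1`.
        have hbr : (0 : ℤ) ≤ (s + k + n - d) * (k + 1) - (s + k) * (d - k) := by
          have e1 : (0 : ℤ) ≤ (n + s - d * (s + 1)) * (k + 1) :=
            mul_nonneg (by linarith) hk1.le
          have e2 : (0 : ℤ) ≤ k * d * (s - 1) := mul_nonneg (by positivity) (by linarith)
          have e3 : (0 : ℤ) ≤ s * k + 2 * k * k + k := by positivity
          linarith
        have key := mul_le_mul_of_nonneg_left (ih2 hk) (mul_nonneg hcoef hk1.le)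
        have key2 := mul_nonneg hc0 hbr
        have hgoal : 0 ≤ ((s : ℤ) + k) * (k + 1) * (s + k + 1) * truncDiff n s d (k + 1) := by
          have e4 : ((s : ℤ) + k) * (k + 1) * (s + k + 1) * truncDiff n s d (k + 1) =
              (s + k + n - d) * (k + 1) * ((s + k) * truncDiff n s d k) -
                (s + k) * (s * n.multichoose s) * (d.choose k * (d - k)) := by
            rw [← hch]
            linear_combination ((s : ℤ) + k) * (k + 1) * hrec
          rw [e4]
          linarith
        exact nonneg_of_mul_nonneg_right hgoal (by positivity)
    · rw [hk.add_one.neg_one_pow, one_mul] at hrec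
      have hc0 : (0 : ℤ) ≤ s * n.multichoose s * d.choose (k + 1) := by positivity
      have hge : (s * n.multichoose s * d.choose (k + 1) : ℤ) ≤
          (s + k + 1) * truncDiff n s d (k + 1) := by linarith
      refine ⟨nonneg_of_mul_nonneg_right (hc0.trans hge) hpos, fun _ => ?_⟩
      push_cast
      linarith

theorem truncDiff_nonneg {n s d : ℕ} (h : d * (s + 1) ≤ n + s) (hdn : d ≤ n) (k : ℕ) :
    0 ≤ truncDiff n s d k :=
  (truncDiff_nonneg_aux h hdn k).1

theorem mk_multichoose_mul_mk_truncDiff (n s d : ℕ) :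
    (mk fun k => (d.multichoose k : ℤ)) * (mk fun k => truncDiff n s d k) =
      mk fun k => (n.multichoose (s + k) : ℤ) := by
  induction d with
  | zero =>
    have : (mk fun k => (Nat.multichoose 0 k : ℤ)) = 1 := by
      ext k
      cases k <;> simp [coeff_one]
    rw [this, one_mul]
    rfl
  | succ d ih =>
    have h1 : (mk fun k => ((d + 1).multichoose k : ℤ)) * (1 - X) =
        mk fun k => (d.multichoose k : ℤ) := by
      ext k
      cases k with
      | zero => simp [mul_sub]
      | succ k =>
        rw [mul_sub, map_sub, mul_one, coeff_succ_mul_X, coeff_mk, coeff_mk, coeff_mk,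
          Nat.multichoose_succ_succ]
        push_cast
        ring
    have h2 : (mk fun k => truncDiff n s (d + 1) k) =
        (1 - X) * mk fun k => truncDiff n s d k := by
      ext k
      cases k with
      | zero => simp [sub_mul, truncDiff]
      | succ k => rw [sub_mul, map_sub, one_mul, coeff_succ_X_mul, coeff_mk, coeff_mk, coeff_mk,
          truncDiff]
    rw [h2, ← mul_assoc, h1, ih]

theorem sum_multichoose_mul_truncDiff (n s d k : ℕ) :
    ∑ p ∈ Finset.HasAntidiagonal.antidiagonal k, (d.multichoose p.1 : ℤ) * truncDiff n s d p.2 =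
      n.multichoose (s + k) := by
  have h := congrArg (coeff k) (mk_multichoose_mul_mk_truncDiff n s d)
  simpa only [coeff_mul, coeff_mk] using h

end Multichoose

open MvPolynomial Module

/-! ### Counting exponents, and graded modules given by a homogeneous basis. -/

section Counting

theorem card_finsupp_degree_eq (n k : ℕ) :
    Nat.card {e : Fin n →₀ ℕ // e.degree = k} = n.multichoose k := by
  classical
  rw [Nat.subtype_card (Finset.finsuppAntidiag Finset.univ k),
    Finset.card_finsuppAntidiag_nat_eq_multichoose, Finset.card_univ, Fintype.card_fin]
  intro e
  rw [Finset.mem_finsuppAntidiag, Finsupp.degree_eq_sum]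
  simp

/-- Counting the elements of given degree in a product of graded sets. -/
theorem card_prod_degree_eq {α β : Type*} (f : α → ℕ) (g : β → ℕ)
    (hf : ∀ k, Finite {a // f a = k}) (hg : ∀ k, Finite {b // g b = k}) (k : ℕ) :
    Nat.card {x : α × β // f x.1 + g x.2 = k} = ∑ p ∈ Finset.HasAntidiagonal.antidiagonal k,
      Nat.card {a // f a = p.1} * Nat.card {b // g b = p.2} := by
  let e : {x : α × β // f x.1 + g x.2 = k} ≃
      Σ p : Finset.HasAntidiagonal.antidiagonal k, {a // f a = p.1.1} × {b // g b = p.1.2} :=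
    { toFun := fun x => ⟨⟨(f x.1.1, g x.1.2), Finset.HasAntidiagonal.mem_antidiagonal.2 x.2⟩,
        ⟨x.1.1, rfl⟩, ⟨x.1.2, rfl⟩⟩
      invFun := fun y => ⟨(y.2.1.1, y.2.2.1), by
        rw [y.2.1.2, y.2.2.2]
        exact Finset.HasAntidiagonal.mem_antidiagonal.1 y.1.2⟩
      left_inv := fun _ => rfl
      right_inv := by
        rintro ⟨⟨⟨i, j⟩, hij⟩, ⟨a, ha⟩, ⟨b, hb⟩⟩
        dsimp only at ha hb
        subst ha hb
        rfl }
  rw [Nat.card_congr e, Nat.card_sigma]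
  simp_rw [Nat.card_prod]
  exact Finset.sum_coe_sort (Finset.HasAntidiagonal.antidiagonal k)
    fun p => Nat.card {a // f a = p.1} * Nat.card {b // g b = p.2}

end Counting

namespace GradedModuleFG

variable {K : Type u} [Field K] {n : ℕ} {M : Type u} [AddCommGroup M] [Module K M]
  [Module (MvPolynomial (Fin n) K) M] [IsScalarTower K (MvPolynomial (Fin n) K) M]

theorem isInternal_span_basis {I : Type*} (b : Basis I K M) (deg : I → ℤ) :
    DirectSum.IsInternal fun k => Submodule.span K (b '' {j | deg j = k}) := by
  classical
  refine DirectSum.isInternal_submodule_of_iSupIndep_of_iSup_eq_top (fun k => ?_) ?_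
  · have h : Disjoint {j | deg j = k} {j | deg j ≠ k} :=
      Set.disjoint_left.2 fun j hj hj' => hj' hj
    refine (b.linearIndependent.disjoint_span_image h).mono_right ?_
    exact iSup₂_le fun k' hk' => Submodule.span_mono <| Set.image_mono fun j hj => by
      rw [Set.mem_ofPred_eq] at hj ⊢
      rwa [hj]
  · rw [← top_le_iff, ← b.span_eq, Submodule.span_le]
    rintro _ ⟨j, rfl⟩
    exact Submodule.mem_iSup_of_mem (deg j) (Submodule.subset_span ⟨j, rfl, rfl⟩)

theorem smul_mem_of_X_smul_mem (P : ℤ → Submodule K M)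
    (hX : ∀ (i : Fin n) (k : ℤ), ∀ x ∈ P k, (X i : MvPolynomial (Fin n) K) • x ∈ P (k + 1))
    (i : ℕ) (k : ℤ) (p : MvPolynomial (Fin n) K) (x : M) (hp : p.IsHomogeneous i) (hx : x ∈ P k) :
    p • x ∈ P (i + k) := by
  have hmon : ∀ (e : Fin n →₀ ℕ) (k : ℤ), ∀ x ∈ P k,
      (monomial e 1 : MvPolynomial (Fin n) K) • x ∈ P (e.degree + k) := by
    intro e
    induction e using Finsupp.induction_linear with
    | zero =>
      intro k x hx
      have h1 : (monomial 0 1 : MvPolynomial (Fin n) K) = 1 := rfl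
      rw [h1, one_smul, map_zero, Nat.cast_zero, zero_add]
      exact hx
    | add e f he hf =>
      intro k x hx
      have h1 : (monomial (e + f) 1 : MvPolynomial (Fin n) K) = monomial e 1 * monomial f 1 := by
        rw [monomial_mul, one_mul]
      rw [h1, mul_smul, map_add, Nat.cast_add, add_assoc]
      exact he _ _ (hf _ _ hx)
    | single l m =>
      intro k x hx
      rw [Finsupp.degree_single]
      induction m with
      | zero =>
        rw [Finsupp.single_zero]
        have h1 : (monomial 0 1 : MvPolynomial (Fin n) K) = 1 := rfl
        rw [h1, one_smul, Nat.cast_zero, zero_add]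
        exact hx
      | succ m ih =>
        have h1 : (monomial (Finsupp.single l (m + 1)) 1 : MvPolynomial (Fin n) K) =
            X l * monomial (Finsupp.single l m) 1 := by
          rw [X, monomial_mul, one_mul, ← Finsupp.single_add, add_comm]
        rw [h1, mul_smul, Nat.cast_add, Nat.cast_one, add_right_comm]
        exact hX l _ _ ih
  rw [p.as_sum, Finset.sum_smul]
  refine sum_mem fun e he => ?_
  have h1 : (monomial e (coeff e p) : MvPolynomial (Fin n) K) = coeff e p • monomial e 1 := by
    rw [smul_monomial, smul_eq_mul, mul_one]
  rw [h1, smul_assoc]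
  refine Submodule.smul_mem _ _ ?_
  have h2 : e.degree = i := by_contra fun h => mem_support_iff.1 he (hp.coeff_eq_zero h)
  rw [← h2]
  exact hmon e k x hx

/-- The graded module with a homogeneous `K`-basis of prescribed degrees. -/
noncomputable def ofBasis [Module.Finite (MvPolynomial (Fin n) K) M] {I : Type*} (b : Basis I K M)
    (deg : I → ℤ) (hX : ∀ i j, (X i : MvPolynomial (Fin n) K) • b j ∈
      Submodule.span K (b '' {j' | deg j' = deg j + 1})) : GradedModuleFG K n where
  carrier := M
  piece k := Submodule.span K (b '' {j | deg j = k})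
  isInternal := isInternal_span_basis b deg
  smul_mem := smul_mem_of_X_smul_mem _ fun i k x hx => by
    induction hx using Submodule.span_induction with
    | mem x hx =>
      obtain ⟨j, hj, rfl⟩ := hx
      rw [← show deg j = k from hj]
      exact hX i j
    | zero => rw [smul_zero]; exact zero_mem _
    | add x y _ _ hx hy => rw [smul_add]; exact add_mem hx hy
    | smul a x _ hx => rw [smul_comm]; exact Submodule.smul_mem _ _ hx

theorem hilbertFunction_ofBasis [Module.Finite (MvPolynomial (Fin n) K) M] {I : Type*}
    (b : Basis I K M) (deg : I → ℤ) (hX : ∀ i j, (X i : MvPolynomial (Fin n) K) • b j ∈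
      Submodule.span K (b '' {j' | deg j' = deg j + 1})) (k : ℤ) :
    (ofBasis b deg hX).hilbertFunction k = Nat.card {j // deg j = k} := by
  have h : b '' {j | deg j = k} = Set.range fun j : {j // deg j = k} => b j := by
    rw [Set.image_eq_range]
    rfl
  change finrank K (Submodule.span K (b '' {j | deg j = k})) = _
  rw [h]
  exact finrank_eq_nat_card_basis
    (Basis.span (b.linearIndependent.comp (Subtype.val : {j // deg j = k} → I)
      Subtype.val_injective))

end GradedModuleFG

/-! ### Regularity of variables acting on a monomial basis. -/

section RegularVariables

open RingTheory.Sequence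

variable {K R M : Type*} [Field K] [CommRing R] [AddCommGroup M] [Module K M] [Module R M]
  [SMulCommClass R K M] {d : ℕ} {C : Type*}

/-- If `M` has a `K`-basis on which `x₁, …, x_d` act like the variables of a polynomial ring,
then `x₁, …, x_d` is a weakly regular sequence on `M`. -/
theorem isWeaklyRegular_ofFn_of_basis (b : Basis ((Fin d →₀ ℕ) × C) K M) (x : Fin d → R)
    (hx : ∀ l a c, x l • b (a, c) = b (a + Finsupp.single l 1, c)) :
    IsWeaklyRegular M (List.ofFn x) := by
  classical
  let S : ℕ → Set ((Fin d →₀ ℕ) × C) := fun i => {j | ∃ l : Fin d, (l : ℕ) < i ∧ 0 < j.1 l}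
  let μ : Fin d → (Fin d →₀ ℕ) × C → (Fin d →₀ ℕ) × C := fun l j => (j.1 + Finsupp.single l 1, j.2)
  have hμ : ∀ l, Function.Injective (μ l) := by
    rintro l ⟨a, c⟩ ⟨a', c'⟩ h
    obtain ⟨h1, h2⟩ := Prod.mk.inj h
    exact Prod.ext (add_right_cancel h1) h2
  have hrepr : ∀ l m, b.repr (x l • m) = (b.repr m).mapDomain (μ l) := by
    intro l m
    have : b.repr.toLinearMap ∘ₗ (DistribSMul.toLinearMap K M (x l)) =
        Finsupp.lmapDomain K K (μ l) ∘ₗ b.repr.toLinearMap := by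
      refine b.ext fun j => ?_
      simp only [LinearMap.comp_apply, LinearEquiv.coe_coe, DistribSMul.toLinearMap_apply,
        Basis.repr_self, Finsupp.lmapDomain_apply, Finsupp.mapDomain_single]
      rw [← Prod.mk.eta (p := j), hx, Basis.repr_self]
    exact LinearMap.congr_fun this m
  have hsupp : ∀ l m, (b.repr (x l • m)).support = (b.repr m).support.image (μ l) := by
    intro l m
    rw [hrepr, Finsupp.mapDomain_support_of_injective (hμ l)]
  -- (x_1, …, x_i)M is spanned by the basis vectors whose exponent involves one of the first i
  -- variables. Multiplying by the next variable shifts exponents injectively and leaves those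
  -- coordinates alone, hence is injective on the quotient.
  have hmem : ∀ (i : ℕ) (m : M),
      m ∈ (Ideal.ofList ((List.ofFn x).take i) • ⊤ : Submodule R M) ↔
        ↑(b.repr m).support ⊆ S i := by
    intro i m
    rw [← b.mem_span_image]
    constructor
    · intro hm
      refine Submodule.smul_induction_on hm (fun r hr m _ => ?_) fun _ _ => add_mem
      induction hr using Submodule.span_induction generalizing m with
      | mem r hr =>
        obtain ⟨k, hk, rfl⟩ := List.mem_take_iff_getElem.1 hr
        rw [List.length_ofFn, lt_min_iff] at hk
        rw [List.getElem_ofFn, b.mem_span_image, hsupp]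
        intro j hj
        obtain ⟨j', -, rfl⟩ := Finset.mem_image.1 (Finset.mem_coe.1 hj)
        exact ⟨⟨k, hk.2⟩, hk.1, by simp [μ]⟩
      | zero => rw [zero_smul]; exact zero_mem _
      | add r r' _ _ h h' => rw [add_smul]; exact add_mem (h m trivial) (h' m trivial)
      | smul a r _ h => rw [smul_eq_mul, mul_comm, mul_smul]; exact h _ trivial
    · intro hm
      rw [b.mem_span_image] at hm
      rw [← b.linearCombination_repr m, Finsupp.linearCombination_apply]
      refine sum_mem fun j hj => ?_
      obtain ⟨l, hl, hjl⟩ := hm hj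
      have hle : Finsupp.single l 1 ≤ j.1 := Finsupp.single_le_iff.2 hjl
      have hb : b j = x l • b (j.1 - Finsupp.single l 1, j.2) := by
        rw [hx, tsub_add_cancel_of_le hle]
      dsimp only
      rw [hb, ← smul_comm]
      refine Submodule.smul_mem_smul (Ideal.subset_span ?_) trivial
      exact List.mem_take_iff_getElem.2 ⟨l, by simp [hl, l.2], by simp⟩
  refine ⟨fun i hi => (isSMulRegular_quotient_iff_mem_of_smul_mem _ _).2 fun m hm => ?_⟩
  rw [List.length_ofFn] at hi
  rw [hmem] at hm ⊢
  rw [List.getElem_ofFn, hsupp] at hm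
  intro j hj
  obtain ⟨l, hl, hjl⟩ := hm (Finset.mem_coe.2 (Finset.mem_image_of_mem _ (Finset.mem_coe.1 hj)))
  refine ⟨l, hl, ?_⟩
  have hne : (⟨i, hi⟩ : Fin d) ≠ l := fun h => by
    rw [← h] at hl
    exact lt_irrefl _ hl
  simpa [μ, Finsupp.single_eq_of_ne hne.symm] using hjl

end RegularVariables

open MvPolynomial Module

/-! ### The Hilbert function of 𝔪^s. -/

section IrrelevantPowHilbert

variable (K : Type u) [Field K] (n s : ℕ)

theorem hilbertFunction_irrelevantPow_of_lt {k : ℤ} (h : k < s) :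
    (irrelevantPow K n s).hilbertFunction k = 0 := by
  change finrank K (irrelevantPowPiece K n s k) = 0
  have : irrelevantPowPiece K n s k = ⊥ := by
    refine (Submodule.eq_bot_iff _).2 fun x hx => Subtype.ext (MvPolynomial.ext _ _ fun e => ?_)
    by_contra h0
    have h1 : (e.degree : ℤ) = k := hx e h0
    exact h0 ((mem_pow_idealOfVars_iff' _ _).1 x.2 e (by omega))
  rw [this, finrank_bot]

theorem hilbertFunction_irrelevantPow_add (k : ℕ) :
    (irrelevantPow K n s).hilbertFunction ((s + k : ℕ) : ℤ) = n.multichoose (s + k) := by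
  change finrank K (irrelevantPowPiece K n s _) = _
  let f : irrelevantPowPiece K n s ((s + k : ℕ) : ℤ) →ₗ[K] MvPolynomial (Fin n) K :=
    { toFun := fun x => x.1.1
      map_add' := fun _ _ => rfl
      map_smul' := fun _ _ => rfl }
  have hf : Function.Injective f := fun x y h => Subtype.ext (Subtype.ext h)
  have hrange : LinearMap.range f = restrictSupport K {e : Fin n →₀ ℕ | e.degree = s + k} := by
    ext p
    rw [mem_restrictSupport_iff]
    constructor
    · rintro ⟨x, rfl⟩ e he
      exact Nat.cast_injective (R := ℤ) (x.2 e (mem_support_iff.1 he))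
    · intro hp
      have hp' : ∀ e, coeff e p ≠ 0 → e.degree = s + k := fun e he => hp (mem_support_iff.2 he)
      refine ⟨⟨⟨p, (mem_pow_idealOfVars_iff' _ _).2 fun e he => ?_⟩, fun e he => ?_⟩, rfl⟩
      · by_contra h0
        have := hp' e h0
        omega
      · rw [hp' e he]
  rw [← LinearMap.finrank_range_of_inj hf, hrange,
    finrank_eq_nat_card_basis (basisRestrictSupport K _)]
  exact card_finsupp_degree_eq n (s + k)

end IrrelevantPowHilbert

/-! ### The module (X_{d+1}, …, X_{d+m})^t ⊕ ⨁ K[X_1, …, X_d](-δ b). -/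

section Construction

theorem coe_basisRestrictSupport {σ : Type*} (K : Type*) [Field K] (S : Set (σ →₀ ℕ)) (e : S) :
    (basisRestrictSupport K S e : MvPolynomial σ K) = monomial e.1 1 := by
  have h : basisRestrictSupport K S e =
      ⟨monomial e.1 1, (monomial_mem_restrictSupport K).2 (Or.inl e.2)⟩ := by
    rw [Basis.apply_eq_iff]
    refine Finsupp.ext fun e' => ?_
    classical
    change coeff e'.1 (monomial e.1 (1 : K)) = _
    rw [coeff_monomial, Finsupp.single_apply]
    simp only [Subtype.ext_iff]
  rw [h]

/-- Separating the exponents of the first `d` variables from those of the last `m` variables. -/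
noncomputable def splitExponents (d m : ℕ) :
    (Fin (d + m) →₀ ℕ) ≃+ (Fin d →₀ ℕ) × (Fin m →₀ ℕ) :=
  (Finsupp.domCongr finSumFinEquiv.symm).trans Finsupp.sumFinsuppAddEquivProdFinsupp

variable {d m : ℕ}

theorem splitExponents_single_castAdd (l : Fin d) (a : ℕ) :
    splitExponents d m (Finsupp.single (Fin.castAdd m l) a) = (Finsupp.single l a, 0) := by
  classical
  refine Prod.ext (Finsupp.ext fun i => ?_) (Finsupp.ext fun i => ?_) <;>
    simp [splitExponents, Finsupp.single_apply]

theorem splitExponents_single_natAdd (l : Fin m) (a : ℕ) :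
    splitExponents d m (Finsupp.single (Fin.natAdd d l) a) = (0, Finsupp.single l a) := by
  classical
  refine Prod.ext (Finsupp.ext fun i => ?_) (Finsupp.ext fun i => ?_) <;>
    simp [splitExponents, Finsupp.single_apply]

theorem isUpperSet_le_degree_splitExponents (t : ℕ) :
    IsUpperSet {e : Fin (d + m) →₀ ℕ | t ≤ (splitExponents d m e).2.degree} := by
  intro e e' hle he
  obtain ⟨f, rfl⟩ := exists_add_of_le hle
  change t ≤ _
  rw [map_add, Prod.snd_add, map_add]
  exact le_add_right he

variable (K : Type u) [Field K]

/-- The `t`-th power of the ideal generated by the last `m` variables. -/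
noncomputable def lastVarsPow (d m t : ℕ) : Ideal (MvPolynomial (Fin (d + m)) K) :=
  restrictSupportIdeal K _ (isUpperSet_le_degree_splitExponents t)

/-- The product index set exhibits freeness over K[X_1, …, X_d], with the monomials of degree at
least t in the last variables as generators. -/
noncomputable def lastVarsPowBasis (d m t : ℕ) :
    Basis ((Fin d →₀ ℕ) × {e : Fin m →₀ ℕ // t ≤ e.degree}) K (lastVarsPow K d m t) :=
  ((basisRestrictSupport K {e : Fin (d + m) →₀ ℕ | t ≤ (splitExponents d m e).2.degree}).map
    { toFun := fun x => ⟨x.1, x.2⟩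
      invFun := fun x => ⟨x.1, x.2⟩
      map_add' := fun _ _ => rfl
      map_smul' := fun _ _ => rfl
      left_inv := fun _ => rfl
      right_inv := fun _ => rfl }).reindex
    { toFun := fun e => ((splitExponents d m e).1, ⟨(splitExponents d m e).2, e.2⟩)
      invFun := fun p => ⟨(splitExponents d m).symm (p.1, p.2), by
        change t ≤ _
        rw [AddEquiv.apply_symm_apply]
        exact p.2.2⟩
      left_inv := fun e => Subtype.ext ((splitExponents d m).symm_apply_apply _)
      right_inv := fun p => by simp }

theorem coe_lastVarsPowBasis (t : ℕ) (p : (Fin d →₀ ℕ) × {e : Fin m →₀ ℕ // t ≤ e.degree}) :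
    (lastVarsPowBasis K d m t p : MvPolynomial (Fin (d + m)) K) =
      monomial ((splitExponents d m).symm (p.1, p.2)) 1 := by
  rw [lastVarsPowBasis, Basis.reindex_apply, Basis.map_apply]
  exact coe_basisRestrictSupport K _ _

theorem X_castAdd_smul_lastVarsPowBasis (t : ℕ) (l : Fin d) (a : Fin d →₀ ℕ)
    (e : {e : Fin m →₀ ℕ // t ≤ e.degree}) :
    (X (Fin.castAdd m l) : MvPolynomial (Fin (d + m)) K) • lastVarsPowBasis K d m t (a, e) =
      lastVarsPowBasis K d m t (a + Finsupp.single l 1, e) := by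
  apply Subtype.ext
  rw [Submodule.coe_smul, coe_lastVarsPowBasis, coe_lastVarsPowBasis, smul_eq_mul, X, monomial_mul,
    one_mul]
  congr 2
  apply (splitExponents d m).injective
  rw [map_add, splitExponents_single_castAdd, AddEquiv.apply_symm_apply, AddEquiv.apply_symm_apply,
    Prod.mk_add_mk, zero_add, add_comm]

theorem X_natAdd_smul_lastVarsPowBasis (t : ℕ) (l : Fin m) (a : Fin d →₀ ℕ)
    (e : {e : Fin m →₀ ℕ // t ≤ e.degree}) :
    (X (Fin.natAdd d l) : MvPolynomial (Fin (d + m)) K) • lastVarsPowBasis K d m t (a, e) =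
      lastVarsPowBasis K d m t (a, ⟨e.1 + Finsupp.single l 1, by
        rw [map_add]; exact le_add_right e.2⟩) := by
  apply Subtype.ext
  rw [Submodule.coe_smul, coe_lastVarsPowBasis, coe_lastVarsPowBasis, smul_eq_mul, X, monomial_mul,
    one_mul]
  congr 2
  apply (splitExponents d m).injective
  rw [map_add, splitExponents_single_natAdd, AddEquiv.apply_symm_apply, AddEquiv.apply_symm_apply,
    Prod.mk_add_mk, zero_add, add_comm]

/-- A finite direct sum of copies of `K[X_1, …, X_d]`, viewed as a module over
`K[X_1, …, X_{d + m}]` on which the last `m` variables act as zero. -/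
def FirstVarsModule (K : Type u) [Field K] (d _m : ℕ) (B : Type) : Type u :=
  B → MvPolynomial (Fin d) K

namespace FirstVarsModule

variable (B : Type)

noncomputable instance : AddCommGroup (FirstVarsModule K d m B) :=
  inferInstanceAs (AddCommGroup (B → MvPolynomial (Fin d) K))

noncomputable instance : Module K (FirstVarsModule K d m B) :=
  inferInstanceAs (Module K (B → MvPolynomial (Fin d) K))

/-- The projection `K[X_1, …, X_{d + m}] → K[X_1, …, X_d]`. -/
noncomputable def killLast (d m : ℕ) : MvPolynomial (Fin (d + m)) K →ₐ[K] MvPolynomial (Fin d) K :=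
  aeval (Fin.addCases X fun _ => 0)

noncomputable instance : Module (MvPolynomial (Fin (d + m)) K) (FirstVarsModule K d m B) :=
  Module.compHom (B → MvPolynomial (Fin d) K) (killLast K d m).toRingHom

variable {K B} in
theorem smul_apply (p : MvPolynomial (Fin (d + m)) K) (x : FirstVarsModule K d m B) (b : B) :
    (p • x) b = killLast K d m p * x b := rfl

instance : IsScalarTower K (MvPolynomial (Fin (d + m)) K) (FirstVarsModule K d m B) where
  smul_assoc a p x := funext fun b => by
    change _ = a • (p • x) b
    rw [smul_apply, smul_apply, map_smul, smul_mul_assoc]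

instance [Fintype B] : Module.Finite (MvPolynomial (Fin (d + m)) K) (FirstVarsModule K d m B) := by
  classical
  have hsurj : Function.Surjective (killLast K d m) := by
    intro p
    refine ⟨rename (Fin.castAdd m) p, ?_⟩
    rw [killLast, aeval_rename]
    have : (Fin.addCases X fun _ => 0 : Fin (d + m) → MvPolynomial (Fin d) K) ∘ Fin.castAdd m =
        X := funext fun i => by simp
    rw [this, aeval_X_left_apply]
  refine ⟨Submodule.fg_def.2 ⟨Set.range fun b : B => (Pi.single b 1 : B → MvPolynomial (Fin d) K),
    Set.finite_range _, top_le_iff.1 fun x _ => ?_⟩⟩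
  choose q hq using fun b => hsurj (x b)
  have hx : x = ∑ b, q b •
      (show FirstVarsModule K d m B from (Pi.single b 1 : B → MvPolynomial (Fin d) K)) := by
    funext b
    refine Eq.trans ?_ (Finset.sum_apply (M := fun _ => MvPolynomial (Fin d) K) b _ _).symm
    rw [Finset.sum_eq_single b]
    · rw [smul_apply, hq]
      rw [Pi.single_eq_same, mul_one]
    · intro b' _ hb
      rw [smul_apply]
      rw [Pi.single_eq_of_ne hb.symm, mul_zero]
    · exact fun h => absurd (Finset.mem_univ b) h
  rw [hx]
  exact sum_mem fun b _ => Submodule.smul_mem _ _ (Submodule.subset_span ⟨b, rfl⟩)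

noncomputable def basis [Fintype B] : Basis ((Fin d →₀ ℕ) × B) K (FirstVarsModule K d m B) :=
  (Pi.basis fun _ : B => basisMonomials (Fin d) K).reindex
    ((Equiv.sigmaEquivProd B (Fin d →₀ ℕ)).trans (Equiv.prodComm _ _))

theorem basis_apply [Fintype B] [DecidableEq B] (a : Fin d →₀ ℕ) (b : B) :
    basis (m := m) K B (a, b) =
      (Pi.single b (monomial a 1) : B → MvPolynomial (Fin d) K) := by
  rw [basis]
  have h := Pi.basis_apply (fun _ : B => basisMonomials (Fin d) K) ⟨b, a⟩
  rw [coe_basisMonomials] at h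
  exact (Basis.reindex_apply (M := B → MvPolynomial (Fin d) K) _ _ (a, b)).trans h

theorem X_castAdd_smul_basis [Fintype B] (l : Fin d) (a : Fin d →₀ ℕ) (b : B) :
    (X (Fin.castAdd m l) : MvPolynomial (Fin (d + m)) K) • basis (m := m) K B (a, b) =
      basis (m := m) K B (a + Finsupp.single l 1, b) := by
  classical
  funext b'
  rw [smul_apply, basis_apply, basis_apply, killLast, aeval_X, Fin.addCases_left]
  by_cases h : b' = b
  · subst h
    rw [Pi.single_eq_same, Pi.single_eq_same, X, monomial_mul, one_mul, add_comm]
  · rw [Pi.single_eq_of_ne h, Pi.single_eq_of_ne h, mul_zero]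

theorem X_natAdd_smul (l : Fin m) (x : FirstVarsModule K d m B) :
    (X (Fin.natAdd d l) : MvPolynomial (Fin (d + m)) K) • x = 0 := by
  funext b
  rw [smul_apply, killLast, aeval_X, Fin.addCases_right, zero_mul]
  rfl

end FirstVarsModule

variable (m) (B : Type) [Fintype B] (t : ℕ)

/-- A homogeneous basis of `(X_{d+1}, …, X_{d+m}) ^ t ⊕ K[X_1, …, X_d] ^ B`. -/
noncomputable def prodBasis (d m t : ℕ) :
    Basis ((Fin d →₀ ℕ) × ({e : Fin m →₀ ℕ // t ≤ e.degree} ⊕ B)) K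
      (lastVarsPow K d m t × FirstVarsModule K d m B) :=
  ((lastVarsPowBasis K d m t).prod (FirstVarsModule.basis K B)).reindex
    (Equiv.prodSumDistrib _ _ _).symm

theorem prodBasis_inl (a : Fin d →₀ ℕ) (e : {e : Fin m →₀ ℕ // t ≤ e.degree}) :
    prodBasis K B d m t (a, Sum.inl e) = (lastVarsPowBasis K d m t (a, e), 0) := by
  refine (Basis.reindex_apply _ _ _).trans ?_
  refine Prod.ext ?_ ?_
  · exact Basis.prod_apply_inl_fst _ _ _
  · exact Basis.prod_apply_inl_snd _ _ _

theorem prodBasis_inr (a : Fin d →₀ ℕ) (b : B) :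
    prodBasis K B d m t (a, Sum.inr b) = (0, FirstVarsModule.basis K B (a, b)) := by
  refine (Basis.reindex_apply _ _ _).trans ?_
  refine Prod.ext ?_ ?_
  · exact Basis.prod_apply_inr_fst _ _ _
  · exact Basis.prod_apply_inr_snd _ _ _

theorem X_castAdd_smul_prodBasis (l : Fin d) (a : Fin d →₀ ℕ)
    (c : {e : Fin m →₀ ℕ // t ≤ e.degree} ⊕ B) :
    (X (Fin.castAdd m l) : MvPolynomial (Fin (d + m)) K) • prodBasis K B d m t (a, c) =
      prodBasis K B d m t (a + Finsupp.single l 1, c) := by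
  rcases c with e | b
  · rw [prodBasis_inl, prodBasis_inl, Prod.smul_mk, smul_zero, X_castAdd_smul_lastVarsPowBasis]
  · rw [prodBasis_inr, prodBasis_inr, Prod.smul_mk, smul_zero,
      FirstVarsModule.X_castAdd_smul_basis]

variable {B m}

/-- The degrees of the generators over `K[X_1, …, X_d]`. -/
noncomputable def generatorDegree (δ : B → ℕ) : {e : Fin m →₀ ℕ // t ≤ e.degree} ⊕ B → ℕ :=
  Sum.elim (fun e => e.1.degree) δ

theorem X_smul_prodBasis_mem (δ : B → ℕ) (i : Fin (d + m))
    (j : (Fin d →₀ ℕ) × ({e : Fin m →₀ ℕ // t ≤ e.degree} ⊕ B)) :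
    (X i : MvPolynomial (Fin (d + m)) K) • prodBasis K B d m t j ∈
      Submodule.span K (prodBasis K B d m t '' {j' |
        ((j'.1.degree + generatorDegree t δ j'.2 : ℕ) : ℤ) =
          ((j.1.degree + generatorDegree t δ j.2 : ℕ) : ℤ) + 1}) := by
  obtain ⟨a, c⟩ := j
  induction i using Fin.addCases with
  | left l =>
    rw [X_castAdd_smul_prodBasis]
    refine Submodule.subset_span ⟨_, ?_, rfl⟩
    change (((a + Finsupp.single l 1).degree + generatorDegree t δ c : ℕ) : ℤ) =
      ((a.degree + generatorDegree t δ c : ℕ) : ℤ) + 1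
    rw [map_add, Finsupp.degree_single]
    push_cast
    ring
  | right l =>
    rcases c with e | b
    · rw [prodBasis_inl, Prod.smul_mk, smul_zero, X_natAdd_smul_lastVarsPowBasis, ← prodBasis_inl]
      refine Submodule.subset_span ⟨_, ?_, rfl⟩
      change ((a.degree + (e.1 + Finsupp.single l 1).degree : ℕ) : ℤ) =
        ((a.degree + e.1.degree : ℕ) : ℤ) + 1
      rw [map_add, Finsupp.degree_single]
      push_cast
      ring
    · rw [prodBasis_inr, Prod.smul_mk, smul_zero, FirstVarsModule.X_natAdd_smul]
      exact zero_mem _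

variable (d m) in
/-- The graded module `(X_{d+1}, …, X_{d+m}) ^ t ⊕ ⨁ b, K[X_1, …, X_d](-δ b)`. -/
noncomputable def powSumModule (δ : B → ℕ) : GradedModuleFG K (d + m) :=
  GradedModuleFG.ofBasis (prodBasis K B d m t)
    (fun j => ((j.1.degree + generatorDegree t δ j.2 : ℕ) : ℤ)) (X_smul_prodBasis_mem K t δ)

theorem le_depth_powSumModule (δ : B → ℕ) : d ≤ (powSumModule d m K t δ).depth := by
  refine le_sSup ⟨List.ofFn fun l : Fin d => X (Fin.castAdd m l), fun r hr => ?_, ?_, by simp⟩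
  · obtain ⟨l, rfl⟩ := (List.mem_ofFn' _ _).1 hr
    exact Ideal.subset_span ⟨_, rfl⟩
  · have h : RingTheory.Sequence.IsWeaklyRegular (lastVarsPow K d m t × FirstVarsModule K d m B)
        (List.ofFn fun l : Fin d => (X (Fin.castAdd m l) : MvPolynomial (Fin (d + m)) K)) :=
      isWeaklyRegular_ofFn_of_basis (prodBasis K B d m t) _
        fun l a c => X_castAdd_smul_prodBasis m K B t l a c
    exact h

end Construction

open MvPolynomial Module

/-! ### The Hilbert function of the constructed module. -/

section HilbertFunction

variable {K : Type u} [Field K] {d m : ℕ}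

theorem finite_finsupp_degree_eq (n k : ℕ) : Finite {e : Fin n →₀ ℕ // e.degree = k} :=
  ((Finsupp.finite_of_degree_le k).subset fun _ h => le_of_eq h).to_subtype

theorem finite_generatorDegree_eq {B : Type} [Fintype B] (t : ℕ) (δ : B → ℕ) (q : ℕ) :
    Finite {c : {e : Fin m →₀ ℕ // t ≤ e.degree} ⊕ B // generatorDegree t δ c = q} := by
  have h : ((Subtype.val : {e : Fin m →₀ ℕ // t ≤ e.degree} → _) ⁻¹'
      {e | e.degree ≤ q}).Finite :=
    (Finsupp.finite_of_degree_le q).preimage Subtype.val_injective.injOn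
  refine Set.Finite.to_subtype (((h.image Sum.inl).union
    ((Set.finite_univ (α := B)).image Sum.inr)).subset ?_)
  rintro (e | b) hc
  · exact Or.inl ⟨e, le_of_eq hc, rfl⟩
  · exact Or.inr ⟨b, trivial, rfl⟩

theorem card_generatorDegree_eq {B : Type} [Fintype B] (t : ℕ) (δ : B → ℕ) (q : ℕ) :
    Nat.card {c : {e : Fin m →₀ ℕ // t ≤ e.degree} ⊕ B // generatorDegree t δ c = q} =
      (if t ≤ q then m.multichoose q else 0) + Nat.card {b // δ b = q} := by
  have := finite_generatorDegree_eq (m := m) t δ q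
  have h1 : Finite {e : {e : Fin m →₀ ℕ // t ≤ e.degree} //
      generatorDegree t δ (Sum.inl e) = q} :=
    Finite.of_injective
      (β := {c : {e : Fin m →₀ ℕ // t ≤ e.degree} ⊕ B // generatorDegree t δ c = q})
      (fun e => ⟨Sum.inl e.1, e.2⟩)
      fun _ _ h => Subtype.ext (Sum.inl_injective (Subtype.ext_iff.1 h))
  rw [Nat.card_congr (Equiv.subtypeSum (p := fun c => generatorDegree t δ c = q)), Nat.card_sum]
  congr 1
  change Nat.card {e : {e : Fin m →₀ ℕ // t ≤ e.degree} // e.1.degree = q} = _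
  split_ifs with htq
  · rw [← card_finsupp_degree_eq]
    refine Nat.card_congr ⟨fun e => ⟨e.1.1, e.2⟩, fun e => ⟨⟨e.1, by rw [e.2]; exact htq⟩, e.2⟩,
      fun _ => rfl, fun _ => rfl⟩
  · refine @Nat.card_of_isEmpty _ ⟨fun e => htq ?_⟩
    rw [← e.2]
    exact e.1.2

theorem hilbertFunction_powSumModule_natCast {B : Type} [Fintype B] (t : ℕ) (δ : B → ℕ) (k : ℕ) :
    (powSumModule d m K t δ).hilbertFunction k = ∑ p ∈ Finset.HasAntidiagonal.antidiagonal k,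
      d.multichoose p.1 *
        ((if t ≤ p.2 then m.multichoose p.2 else 0) + Nat.card {b // δ b = p.2}) := by
  rw [powSumModule, GradedModuleFG.hilbertFunction_ofBasis]
  simp only [Nat.cast_inj]
  rw [card_prod_degree_eq (fun a : Fin d →₀ ℕ => a.degree) (generatorDegree t δ)
    (finite_finsupp_degree_eq d) (finite_generatorDegree_eq t δ)]
  simp only [card_finsupp_degree_eq, card_generatorDegree_eq]

theorem hilbertFunction_powSumModule_of_neg {B : Type} [Fintype B] (t : ℕ) (δ : B → ℕ) {k : ℤ}
    (hk : k < 0) : (powSumModule d m K t δ).hilbertFunction k = 0 := by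
  rw [powSumModule, GradedModuleFG.hilbertFunction_ofBasis]
  refine @Nat.card_of_isEmpty _ ⟨fun j => ?_⟩
  have := j.2
  omega

end HilbertFunction

/-! ### The two depth bounds. -/

section HilbertDepth

variable (K : Type u) [Field K]

/-- Shifts of the copies of `K[X_1, …, X_d]`: there are `g k` copies with shift `s + k`. -/
def shiftDegree (s : ℕ) {d : ℕ} (g : ℕ → ℕ) : (Σ k : Fin d, Fin (g k)) → ℕ := fun b => s + b.1

theorem card_shiftDegree_eq (s : ℕ) {d : ℕ} (g : ℕ → ℕ) (k : ℕ) :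
    Nat.card {b : Σ k : Fin d, Fin (g k) // shiftDegree s g b = s + k} =
      if k < d then g k else 0 := by
  split_ifs with hk
  · let e : {b : Σ k : Fin d, Fin (g k) // shiftDegree s g b = s + k} ≃ Fin (g k) :=
      { toFun := fun b => Fin.cast (by rw [Nat.add_left_cancel b.2]) b.1.2
        invFun := fun i => ⟨⟨⟨k, hk⟩, i⟩, rfl⟩
        left_inv := by
          rintro ⟨⟨⟨k', hk'⟩, i⟩, hb⟩
          obtain rfl : k' = k := Nat.add_left_cancel hb
          rfl
        right_inv := fun _ => rfl }
    rw [Nat.card_congr e, Nat.card_fin]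
  · refine @Nat.card_of_isEmpty _ ⟨fun b => hk ?_⟩
    rw [← Nat.add_left_cancel b.2]
    exact b.1.1.2

theorem card_shiftDegree_eq_of_lt (s : ℕ) {d : ℕ} (g : ℕ → ℕ) {q : ℕ} (hq : q < s) :
    Nat.card {b : Σ k : Fin d, Fin (g k) // shiftDegree s g b = q} = 0 := by
  refine @Nat.card_of_isEmpty _ ⟨fun b => ?_⟩
  have h : s + b.1.1 = q := b.2
  omega

/-- There is a graded module with the Hilbert function of `𝔪 ^ s` and depth at least `d`. -/
theorem exists_le_depth_of_mul_le {n s d : ℕ} (h : d * (s + 1) ≤ n + s) (hdn : d ≤ n) :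
    ∃ N : GradedModuleFG K n, N.hilbertFunction = (irrelevantPow K n s).hilbertFunction ∧
      d ≤ N.depth := by
  obtain ⟨m, rfl⟩ : ∃ m, n = d + m := ⟨n - d, by omega⟩
  let g : ℕ → ℕ := fun k => (truncDiff (d + m) s d k).toNat
  refine ⟨powSumModule d m K (s + d) (shiftDegree (d := d) s g), funext fun k => ?_,
    le_depth_powSumModule _ _ _⟩
  -- The generators over K[X_1, …, X_d] realise (1-T)^d H(T): the ideal power provides degrees q ≥
  -- s+d, the shifted copies degrees s ≤ q < s+d. Nonnegativity is what lets `toNat` in `g` lose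
  -- nothing.
  have hgen : ∀ q, ((if s + d ≤ q then m.multichoose q else 0) +
      Nat.card {b : Σ k : Fin d, Fin (g k) // shiftDegree s g b = q} : ℕ) =
      if s ≤ q then truncDiff (d + m) s d (q - s) else 0 := by
    intro q
    split_ifs with h1 h2 h2
    · obtain ⟨j, rfl⟩ := Nat.exists_eq_add_of_le h2
      rw [card_shiftDegree_eq, if_neg (by omega), Nat.add_sub_cancel_left,
        truncDiff_of_le d hdn (by omega), Nat.add_sub_cancel_left, add_zero]
    · omega
    · obtain ⟨j, rfl⟩ := Nat.exists_eq_add_of_le h2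
      rw [card_shiftDegree_eq, if_pos (by omega), Nat.add_sub_cancel_left, zero_add]
      exact Int.toNat_of_nonneg (truncDiff_nonneg h hdn j)
    · rw [card_shiftDegree_eq_of_lt s g (by omega)]
      rfl
  rcases lt_or_ge k 0 with hk | hk
  · rw [hilbertFunction_powSumModule_of_neg _ _ hk, hilbertFunction_irrelevantPow_of_lt _ _ _
      (by omega)]
  obtain ⟨q, rfl⟩ := Int.eq_ofNat_of_zero_le hk
  rw [hilbertFunction_powSumModule_natCast]
  apply Nat.cast_injective (R := ℤ)
  rw [Nat.cast_sum]
  simp_rw [Nat.cast_mul, hgen]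
  rcases lt_or_ge q s with hq | hq
  · rw [hilbertFunction_irrelevantPow_of_lt _ _ _ (by omega), Nat.cast_zero]
    refine Finset.sum_eq_zero fun p hp => ?_
    have := Finset.HasAntidiagonal.mem_antidiagonal.1 hp
    rw [if_neg (by omega), mul_zero]
  · obtain ⟨j, rfl⟩ := Nat.exists_eq_add_of_le hq
    rw [hilbertFunction_irrelevantPow_add, ← sum_multichoose_mul_truncDiff (d + m) s d j]
    symm
    -- Pairs outside the image have second entry below s, where there are no generators.
    refine Finset.sum_of_injOn (fun p => (p.1, s + p.2)) ?_ ?_ ?_ ?_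
    · rintro ⟨a, b⟩ _ ⟨a', b'⟩ _ hab
      obtain ⟨h1, h2⟩ := Prod.mk.inj hab
      exact Prod.ext h1 (Nat.add_left_cancel h2)
    · intro p hp
      have := Finset.HasAntidiagonal.mem_antidiagonal.1 (Finset.mem_coe.1 hp)
      refine Finset.mem_coe.2 (Finset.HasAntidiagonal.mem_antidiagonal.2 ?_)
      dsimp only
      omega
    · rintro ⟨a, b⟩ hp hp'
      have hab : a + b = s + j := Finset.HasAntidiagonal.mem_antidiagonal.1 hp
      rw [if_neg, mul_zero]
      intro hsb
      refine hp' ⟨(a, b - s), Finset.mem_coe.2 (Finset.HasAntidiagonal.mem_antidiagonal.2 ?_), ?_⟩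
      · dsimp only at hsb ⊢
        omega
      · exact Prod.ext rfl (Nat.add_sub_of_le hsb)
    · intro p _
      dsimp only
      rw [if_pos (Nat.le_add_right _ _), Nat.add_sub_cancel_left]

/-- Every graded module with the Hilbert function of `𝔪 ^ s` has depth `l` with
`l * (s + 1) ≤ n + s`. -/
theorem length_mul_le_of_hilbertFunction_eq {n s : ℕ} (hns : 0 < n ∨ s = 0)
    {N : GradedModuleFG K n} (hN : N.hilbertFunction = (irrelevantPow K n s).hilbertFunction)
    {rs : List (MvPolynomial (Fin n) K)} (hrs : ∀ r ∈ rs, r ∈ idealOfVars (Fin n) K)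
    (hreg : RingTheory.Sequence.IsWeaklyRegular N.carrier rs) :
    rs.length * (s + 1) ≤ n + s := by
  have h := N.length_mul_hilbertFunction_le (s := s)
    (fun k hk => by rw [hN, hilbertFunction_irrelevantPow_of_lt _ _ _ hk]) hrs hreg
  have h0 := hilbertFunction_irrelevantPow_add K n s 0
  have h1 := hilbertFunction_irrelevantPow_add K n s 1
  rw [Nat.cast_add, Nat.cast_one] at h1
  rw [add_zero] at h0
  rw [hN, h0, h1] at h
  -- Cancelling h(s) is where 𝔪^s ≠ 0 is needed.
  refine Nat.le_of_mul_le_mul_right ?_ (multichoose_pos hns)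
  calc rs.length * (s + 1) * n.multichoose s = (s + 1) * (rs.length * n.multichoose s) := by ring
    _ ≤ (s + 1) * n.multichoose (s + 1) := Nat.mul_le_mul_left _ h
    _ = (n + s) * n.multichoose s := succ_mul_multichoose_succ n s

theorem pos_or_eq_zero_of_idealOfVars_pow_ne_bot {n s : ℕ}
    (hne : idealOfVars (Fin n) K ^ s ≠ ⊥) : 0 < n ∨ s = 0 := by
  by_contra! h
  obtain ⟨h1, h2⟩ := h
  obtain rfl : n = 0 := by omega
  refine hne ?_
  have : idealOfVars (Fin 0) K = ⊥ := by
    rw [idealOfVars, Set.range_eq_empty, Ideal.span_empty]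
  rw [this, ← Ideal.zero_eq_bot, zero_pow h2]

/-- For l+1 in place of l, the left side says l(s+1) < n, that is, l < n/(s+1). -/
theorem mul_le_iff_le_ceil {n s l : ℕ} :
    l * (s + 1) ≤ n + s ↔ l ≤ ⌈(n : ℚ) / ((s : ℚ) + 1)⌉₊ := by
  have hs : (0 : ℚ) < s + 1 := by positivity
  rcases l with _ | l
  · simp
  · rw [Nat.succ_le_iff, Nat.lt_ceil, lt_div_iff₀ hs]
    have : (l : ℚ) * (s + 1) < n ↔ l * (s + 1) < n := by exact_mod_cast Iff.rfl
    rw [this, add_mul]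
    omega

end HilbertDepth

theorem theorem2 (K : Type u) [Field K] (n s : ℕ)
    (hne : MvPolynomial.idealOfVars (Fin n) K ^ s ≠ ⊥) :
    (irrelevantPow K n s).IsHilbertDepth (⌈(n : ℚ) / ((s : ℚ) + 1)⌉₊ : ℕ∞) := by
  have hns := pos_or_eq_zero_of_idealOfVars_pow_ne_bot K hne
  have hle : ∀ N : GradedModuleFG K n,
      N.hilbertFunction = (irrelevantPow K n s).hilbertFunction →
        N.depth ≤ (⌈(n : ℚ) / ((s : ℚ) + 1)⌉₊ : ℕ∞) := by
    refine fun N hN => sSup_le ?_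
    rintro _ ⟨rs, hrs, hreg, rfl⟩
    exact_mod_cast mul_le_iff_le_ceil.1 (length_mul_le_of_hilbertFunction_eq K hns hN hrs hreg)
  -- The construction splits off d of the n variables, so it needs d ≤ n.
  have hd : ⌈(n : ℚ) / ((s : ℚ) + 1)⌉₊ ≤ n := by
    refine Nat.ceil_le.2 (div_le_self (Nat.cast_nonneg n) ?_)
    have : (0 : ℚ) ≤ s := Nat.cast_nonneg s
    linarith
  constructor
  · obtain ⟨N, hN, hdepth⟩ := exists_le_depth_of_mul_le K (mul_le_iff_le_ceil.2 le_rfl) hd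
    exact ⟨N, hN, le_antisymm hdepth (hle N hN)⟩
  · rintro _ ⟨N, hN, rfl⟩
    exact hle N hN
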